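/- A seller offers a finite set $I$ of items to a single buyer. A valuation is a monotone function $v:2^{I}\to\mathbb{R}_{\ge 0}$ with $v(\emptyset)=0$; it is additive if $v(S)=\sum_{i\in S}v(\{i\})$ for all $S\subseteq I$. For a probability distribution $D$ over valuations, let $\mathrm{Rev}(D)\in[0,\infty]$ be the supremum of the expected payment $\mathbb{E}_{v\leftarrow D}[p(v)]$ over all truthful mechanisms: a mechanism assigns to each reported valuation $w$ a lottery $(A_w(S))_{S\subseteq I}$ over sets of items and an (expected) price $p(w)\in\mathbb{R}$, measurably in $w$, and it is truthful if, for all $v,w$ in the support of $D$, $\sum_S A_v(S)v(S)-p(v)\ge \sum_S A_w(S)v(S)-p(w)$ and $\sum_S A_v(S)v(S)-p(v)\ge 0$. A distribution $D^{+}$ first-order stochastically dominates $D$ if the two can be coupled so that, when $(v^{+},v)$ is drawn from the coupling, almost surely $v^{+}(S)\ge v(S)$ for all $S$. A class of distributions is $c$-approximately revenue monotone if $c\cdot\mathrm{Rev}(D^{+})\ge\mathrm{Rev}(D)$ for all $D,D^{+}$ in the class such that $D^{+}$ first-order stochastically dominates $D$. The class of correlated additive valuations for two items consists of all probability distributions over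 additive valuations for two items (the values of the two items may be arbitrarily correlated). **Corollary.** There exist distributions $D$ and $D^{+}$ over correlated additive valuations for two items such that $D^{+}$ first-order stochastically dominates $D$, $\mathrm{Rev}(D^{+})=1$, and yet $\mathrm{Rev}(D)=\infty$. Therefore, the class of correlated additive valuations for two items is not $c$-approximately revenue monotone for any finite $c\in\mathbb{R}$. -/

import Mathlib

open MeasureTheory

noncomputable section

/-- A valuation of a buyer over the finite set `ι` of items: it assigns a value `v S` to every set
`S` of items, gives value `0` to the empty set, and is monotone (so all values are nonnegative). -/
abbrev BuyerValuation (ι : Type*) : Type _ :=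
  {v : Finset ι → ℝ // v ∅ = 0 ∧ Monotone v}

/-- The value of `S` is the sum of the values of the single items in `S`. -/
def IsAdditiveValuation {ι : Type*} (v : BuyerValuation ι) : Prop :=
  ∀ S : Finset ι, v.1 S = ∑ i ∈ S, v.1 {i}

/-- A direct-revelation mechanism. On report `v` the buyer receives the random set that equals `S`
with probability `alloc v S`, and pays the (expected) price `price v`, which may be negative. -/
structure Mechanism (ι : Type*) [Fintype ι] where
  alloc : BuyerValuation ι → Finset ι → ℝ
  price : BuyerValuation ι → ℝ
  alloc_nonneg : ∀ v S, 0 ≤ alloc v S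
  alloc_sum : ∀ v, ∑ S, alloc v S = 1
  measurable_alloc : Measurable alloc
  measurable_price : Measurable price

namespace Mechanism

variable {ι : Type*} [Fintype ι]

/-- Expected quasi-linear utility of a buyer with valuation `v` who reports `w`. -/
def utility (M : Mechanism ι) (v w : BuyerValuation ι) : ℝ :=
  ∑ S, M.alloc w S * v.1 S - M.price w

/-- For a buyer with valuation drawn from `D`, reporting truthfully is optimal
(incentive compatibility) and is at least as good as not participating (individual rationality). -/
def IsTruthful (M : Mechanism ι) (D : ProbabilityMeasure (BuyerValuation ι)) : Prop :=
  (∀ v ∈ (D : Measure (BuyerValuation ι)).support, ∀ w ∈ (D : Measure (BuyerValuation ι)).support,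
    M.utility v w ≤ M.utility v v) ∧
  ∀ v ∈ (D : Measure (BuyerValuation ι)).support, 0 ≤ M.utility v v

/-- The expected payment `E[price v]`, as an extended real: the expectation of the positive part
minus that of the negative part. The latter is finite for every truthful mechanism, since
incentive compatibility bounds the prices on the support from below. -/
def revenue (M : Mechanism ι) (D : ProbabilityMeasure (BuyerValuation ι)) : EReal :=
  ((∫⁻ v, ENNReal.ofReal (M.price v) ∂(D : Measure (BuyerValuation ι)) : ENNReal) : EReal) -
    ((∫⁻ v, ENNReal.ofReal (-M.price v) ∂(D : Measure (BuyerValuation ι)) : ENNReal) : EReal)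

end Mechanism

/-- The optimal revenue: the supremum of the revenues of all truthful mechanisms. -/
def Rev {ι : Type*} [Fintype ι] (D : ProbabilityMeasure (BuyerValuation ι)) : EReal :=
  ⨆ M : {M : Mechanism ι // M.IsTruthful D}, M.1.revenue D

/-- `Dplus` first-order stochastically dominates `D`: there is a coupling of `Dplus` and `D` under
which, almost surely, the first valuation is at least the second one on every set of items. -/
def StochDominates {ι : Type*} (Dplus D : ProbabilityMeasure (BuyerValuation ι)) : Prop :=
  ∃ π : ProbabilityMeasure (BuyerValuation ι × BuyerValuation ι),
    (π : Measure (BuyerValuation ι × BuyerValuation ι)).map Prod.fst = (Dplus : Measure (BuyerValuation ι)) ∧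
    (π : Measure (BuyerValuation ι × BuyerValuation ι)).map Prod.snd = (D : Measure (BuyerValuation ι)) ∧
    ∀ᵐ q ∂(π : Measure (BuyerValuation ι × BuyerValuation ι)), ∀ S : Finset ι, q.2.1 S ≤ q.1.1 S

/-- The class of distributions over (arbitrarily correlated) additive valuations. -/
def correlatedAdditive (ι : Type*) : Set (ProbabilityMeasure (BuyerValuation ι)) :=
  {D | ∀ᵐ v ∂(D : Measure (BuyerValuation ι)), IsAdditiveValuation v}

/-- The class `C` of distributions is `α`-approximately revenue monotone. -/
def ApproxRevenueMonotone {ι : Type*} [Fintype ι] (α : ℝ)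
    (C : Set (ProbabilityMeasure (BuyerValuation ι))) : Prop :=
  ∀ D ∈ C, ∀ Dplus ∈ C, StochDominates Dplus D → Rev D ≤ (α : EReal) * Rev Dplus

end

/-!
The valuations in both distributions are indexed by `n : ℕ`, with probabilities
`1 / b n - 1 / b (n + 1)` for a rapidly increasing sequence `b` with `b 0 = 1`, so that the tail
`{n, n + 1, …}` has probability exactly `1 / b n`.

* The dominating distribution gives both items the value `b n / 2`. All its valuations are
  multiples of one another, and the value of the bundle is an equal-revenue distribution: every
  price `b n` for the bundle earns `1`. A discrete version of Myerson's argument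
  (`sum_mul_max_price_le_one`) shows that no truthful mechanism earns more.

* The dominated distribution gives the items the values `(b n / 2) * x n` and `b n / 2` with
  `x n ∈ [0, 1]`. Consider the lotteries `g n = (x n, (1 - x n ^ 2) / 2 + r n / 2)`. They lie on
  translates of a concave parabola whose normal direction at `g n` is `(x n, 1)`, so that
  `(g n - g j) · (x n, 1) = (x n - x j) ^ 2 / 2 + (r n - r j) / 2`. The points are put on shells,
  the `k`-th one with `2 * k + 1` equally spaced values of `x` and with `r = 1 - 1 / (k + 1)`.
  Points of the same shell differ by `1 / (2 * k + 1)` in `x`, and points of different shells differ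
  enough in `r`, so that the gap above is at least `1 / (18 * (n + 1))` for all `j < n`
  (`gap_le_menuItem_sub`). As in the construction of Hart and Nisan, one may thus charge
  `b n / 2` times this gap for `g n`: the buyer `n` does not want to imitate any `j < n`, and the
  lotteries with larger index are unaffordable because `b` grows quickly. The expected payment
  dominates a harmonic series.
-/

open Finset

/-! ### Discrete distributions over valuations -/

/-- The additive valuation in which the value of the single item `i` is `f i`. -/
def additiveValuation {ι : Type*} (f : ι → ℝ) (hf : ∀ i, 0 ≤ f i) : BuyerValuation ι :=
  ⟨fun S => ∑ i ∈ S, f i, by simp, fun _ _ h =>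
    Finset.sum_le_sum_of_subset_of_nonneg h fun i _ _ => hf i⟩

lemma isAdditiveValuation_additiveValuation {ι : Type*} (f : ι → ℝ) (hf : ∀ i, 0 ≤ f i) :
    IsAdditiveValuation (additiveValuation f hf) := by
  intro S
  simp [additiveValuation]

/-- The scale of the `n`-th valuation: under the dominating distribution it is the value of the
grand bundle. -/
noncomputable def scale (n : ℕ) : ℝ := 36 ^ n * ((n + 1).factorial : ℝ)

lemma scale_zero : scale 0 = 1 := by simp [scale]

lemma scale_succ (n : ℕ) : scale (n + 1) = 36 * ((n : ℝ) + 2) * scale n := by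
  simp only [scale, Nat.factorial_succ (n + 1)]
  push_cast
  ring

lemma scale_pos (n : ℕ) : 0 < scale n := by
  unfold scale
  positivity

lemma two_mul_scale_le_succ (n : ℕ) : 2 * scale n ≤ scale (n + 1) := by
  rw [scale_succ]
  have := scale_pos n
  have hn : (0 : ℝ) ≤ n := n.cast_nonneg
  nlinarith [mul_nonneg hn this.le]

lemma scale_monotone : Monotone scale :=
  monotone_nat_of_le_succ fun n => by linarith [two_mul_scale_le_succ n, scale_pos n]

lemma one_le_scale (n : ℕ) : 1 ≤ scale n := scale_zero ▸ scale_monotone n.zero_le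

lemma two_pow_le_scale (n : ℕ) : (2 : ℝ) ^ n ≤ scale n := by
  induction n with
  | zero => simp [scale_zero]
  | succ n ih =>
    rw [pow_succ]
    linarith [two_mul_scale_le_succ n]

lemma one_le_scale_sub {m n : ℕ} (h : m < n) : 1 ≤ scale n - scale m := by
  have := scale_monotone (Nat.succ_le_of_lt h)
  have h2 := two_mul_scale_le_succ m
  have := one_le_scale m
  simp only [Nat.succ_eq_add_one] at *
  linarith

lemma one_le_abs_scale_sub {m n : ℕ} (h : m ≠ n) : 1 ≤ |scale m - scale n| := by
  rcases lt_or_gt_of_ne h with h | h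
  · rw [abs_sub_comm]
    exact (one_le_scale_sub h).trans (le_abs_self _)
  · exact (one_le_scale_sub h).trans (le_abs_self _)

/-- The probability of the `n`-th valuation. -/
noncomputable def weight (n : ℕ) : ℝ := 1 / scale n - 1 / scale (n + 1)

lemma half_inv_scale_le_weight (n : ℕ) : 1 / (2 * scale n) ≤ weight n := by
  have h := scale_pos n
  have h2 : 1 / scale (n + 1) ≤ 1 / (2 * scale n) :=
    one_div_le_one_div_of_le (by positivity) (two_mul_scale_le_succ n)
  have h3 : 1 / scale n = 1 / (2 * scale n) + 1 / (2 * scale n) := by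
    field_simp
    norm_num
  unfold weight
  linarith

lemma weight_pos (n : ℕ) : 0 < weight n :=
  lt_of_lt_of_le (by have := scale_pos n; positivity) (half_inv_scale_le_weight n)

lemma hasSum_weight : HasSum weight 1 := by
  rw [hasSum_iff_tendsto_nat_of_nonneg fun n => (weight_pos n).le]
  have h (N : ℕ) : ∑ n ∈ range N, weight n = 1 - 1 / scale N := by
    simp only [weight]
    rw [Finset.sum_range_sub' (fun n => 1 / scale n), scale_zero]
    norm_num
  simp only [h]
  have h0 : Filter.Tendsto (fun N => 1 / scale N) Filter.atTop (nhds 0) := by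
    simp only [one_div]
    exact (Filter.tendsto_atTop_mono two_pow_le_scale
      (tendsto_pow_atTop_atTop_of_one_lt one_lt_two)).inv_tendsto_atTop
  simpa using h0.const_sub 1

/-- The distribution on indices. -/
noncomputable def indexPMF : PMF ℕ :=
  ⟨fun n => ENNReal.ofReal (weight n), by
    have h := ENNReal.ofReal_tsum_of_nonneg (fun n => (weight_pos n).le) hasSum_weight.summable
    rw [hasSum_weight.tsum_eq, ENNReal.ofReal_one] at h
    rw [h]
    exact ENNReal.summable.hasSum⟩

lemma indexPMF_toMeasure_singleton (n : ℕ) :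
    indexPMF.toMeasure {n} = ENNReal.ofReal (weight n) := by
  rw [PMF.toMeasure_apply_singleton _ _ (measurableSet_singleton n)]
  rfl

/-- The distribution of `V n`, where the index `n` has probability `weight n`. -/
noncomputable def indexedDistribution {X : Type*} [MeasurableSpace X] (V : ℕ → X) : ProbabilityMeasure X :=
  ⟨indexPMF.toMeasure.map V,
    Measure.isProbabilityMeasure_map (measurable_of_countable V).aemeasurable⟩

lemma coe_indexedDistribution {X : Type*} [MeasurableSpace X] (V : ℕ → X) :
    (indexedDistribution V : Measure X) = indexPMF.toMeasure.map V := rfl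

lemma lintegral_indexedDistribution {X : Type*} [MeasurableSpace X] (V : ℕ → X)
    {f : X → ENNReal} (hf : Measurable f) :
    ∫⁻ v, f v ∂(indexedDistribution V : Measure X) =
      ∑' n, f (V n) * ENNReal.ofReal (weight n) := by
  rw [coe_indexedDistribution, lintegral_map hf (measurable_of_countable V), lintegral_countable']
  simp only [indexPMF_toMeasure_singleton]

lemma ae_indexedDistribution {X : Type*} [MeasurableSpace X] [MeasurableSingletonClass X]
    (V : ℕ → X) {p : X → Prop} (h : ∀ n, p (V n)) :
    ∀ᵐ v ∂(indexedDistribution V : Measure X), p v := by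
  rw [coe_indexedDistribution]
  have hr : ∀ᵐ v ∂(indexPMF.toMeasure.map V), v ∈ Set.range V :=
    (ae_map_iff (measurable_of_countable V).aemeasurable
      (Set.countable_range V).measurableSet).2 (ae_of_all _ fun n => Set.mem_range_self n)
  filter_upwards [hr] with v hv
  obtain ⟨n, rfl⟩ := hv
  exact h n

/-- If the values of one item are the half scales, then the valuations form a closed discrete set,
so that the support of the distribution contains no further valuation. -/
lemma support_indexedDistribution {V : ℕ → BuyerValuation (Fin 2)}
    (hV : ∀ n, (V n).1 {1} = scale n / 2) :
    (indexedDistribution V : Measure (BuyerValuation (Fin 2))).support = Set.range V := by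
  apply Set.Subset.antisymm
  · apply Measure.support_subset_of_isClosed
    · refine Metric.isClosed_of_pairwise_le_dist (ε := 1 / 2) (by norm_num) ?_
      rintro _ ⟨m, rfl⟩ _ ⟨n, rfl⟩ hmn
      have hmn' : m ≠ n := fun h => hmn (h ▸ rfl)
      have h1 : dist ((V m).1 {1}) ((V n).1 {1}) ≤ dist (V m) (V n) :=
        dist_le_pi_dist (V m).1 (V n).1 {1}
      rw [hV, hV, Real.dist_eq, ← sub_div, abs_div, abs_two] at h1
      linarith [one_le_abs_scale_sub hmn']
    · exact ae_indexedDistribution V fun n => Set.mem_range_self n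
  · rintro _ ⟨n, rfl⟩
    rw [Measure.mem_support_iff_forall]
    intro U hU
    have hm : (indexedDistribution V : Measure (BuyerValuation (Fin 2))) {V n} ≤
        (indexedDistribution V : Measure (BuyerValuation (Fin 2))) U :=
      measure_mono (Set.singleton_subset_iff.2 (mem_of_mem_nhds hU))
    refine lt_of_lt_of_le ?_ hm
    rw [coe_indexedDistribution,
      Measure.map_apply (measurable_of_countable V) (measurableSet_singleton _)]
    have h2 : indexPMF.toMeasure {n} ≤ indexPMF.toMeasure (V ⁻¹' {V n}) :=
      measure_mono (by simp)
    refine lt_of_lt_of_le ?_ h2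
    rw [indexPMF_toMeasure_singleton, ENNReal.ofReal_pos]
    exact weight_pos n

lemma indexedDistribution_mem_correlatedAdditive {V : ℕ → BuyerValuation (Fin 2)}
    (hV : ∀ n, IsAdditiveValuation (V n)) :
    indexedDistribution V ∈ correlatedAdditive (Fin 2) :=
  ae_indexedDistribution V hV

lemma stochDominates_indexedDistribution {V W : ℕ → BuyerValuation (Fin 2)}
    (h : ∀ n S, (V n).1 S ≤ (W n).1 S) :
    StochDominates (indexedDistribution W) (indexedDistribution V) := by
  refine ⟨indexedDistribution fun n => (W n, V n), ?_, ?_, ae_indexedDistribution _ h⟩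
  · rw [coe_indexedDistribution, Measure.map_map measurable_fst (measurable_of_countable _)]
    rfl
  · rw [coe_indexedDistribution, Measure.map_map measurable_snd (measurable_of_countable _)]
    rfl

/-! ### The dominating distribution -/

/-- The `n`-th valuation of the dominating distribution. -/
noncomputable def symmetricValuation (n : ℕ) : BuyerValuation (Fin 2) :=
  additiveValuation (fun _ => scale n / 2) fun _ => by linarith [scale_pos n]

lemma symmetricValuation_apply (n : ℕ) (S : Finset (Fin 2)) :
    (symmetricValuation n).1 S = (#S : ℝ) / 2 * scale n := by
  simp [symmetricValuation, additiveValuation]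
  ring

lemma support_symmetricValuation :
    (indexedDistribution symmetricValuation : Measure (BuyerValuation (Fin 2))).support =
      Set.range symmetricValuation :=
  support_indexedDistribution fun n => by rw [symmetricValuation_apply]; simp; ring

/-- Myerson's bound for the valuations `scale n`: here `q n` is the (normalized) allocation and
`p n` the price of the type `n`. The proof shows by induction that the revenue from the types
below `N`, plus the revenue from charging the price of `N` to all types from `N` on, is at most
`q N`; negative prices are replaced by `0`. -/
lemma sum_mul_max_price_le_one {q p : ℕ → ℝ} (hq : ∀ n, q n ≤ 1) (hq0 : 0 ≤ q 0)
    (hir : p 0 ≤ q 0 * scale 0)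
    (hic : ∀ m n, q n * scale m - p n ≤ q m * scale m - p m) (N : ℕ) :
    ∑ n ∈ range N, max (p n) 0 * weight n ≤ 1 := by
  have key : ∀ N, ∑ n ∈ range N, max (p n) 0 * weight n + max (p N) 0 / scale N ≤ q N := by
    intro N
    induction N with
    | zero =>
      rw [scale_zero, mul_one] at hir
      simpa [scale_zero] using ⟨hir, hq0⟩
    | succ N ih =>
      have hs := scale_pos N
      have hs' := scale_pos (N + 1)
      have h1 := hic (N + 1) N
      have h2 := hic N (N + 1)
      -- Adding the two incentive constraints shows that the allocation is monotone.
      have hmono : 0 ≤ q (N + 1) - q N := by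
        have h3 : 0 ≤ (q (N + 1) - q N) * (scale (N + 1) - scale N) := by linarith
        have h4 := one_le_scale_sub N.lt_succ_self
        exact nonneg_of_mul_nonneg_left h3 (by simp only [Nat.succ_eq_add_one] at h4; linarith)
      have h5 : max (p (N + 1)) 0 ≤ max (p N) 0 + (q (N + 1) - q N) * scale (N + 1) := by
        have := mul_nonneg hmono hs'.le
        apply max_le
        · linarith [le_max_left (p N) 0]
        · linarith [le_max_right (p N) 0]
      have h6 : max (p (N + 1)) 0 / scale (N + 1) ≤
          max (p N) 0 / scale (N + 1) + (q (N + 1) - q N) := by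
        rw [div_le_iff₀ hs', add_mul, div_mul_cancel₀ _ hs'.ne']
        exact h5
      have h7 : max (p N) 0 * weight N = max (p N) 0 / scale N - max (p N) 0 / scale (N + 1) := by
        unfold weight
        ring
      rw [sum_range_succ, h7]
      linarith
  have h := key N
  have : 0 ≤ max (p N) 0 / scale N := div_nonneg (le_max_right _ _) (scale_pos N).le
  linarith [hq N]

lemma revenue_symmetricValuation_le_one (M : Mechanism (Fin 2))
    (hM : M.IsTruthful (indexedDistribution symmetricValuation)) :
    M.revenue (indexedDistribution symmetricValuation) ≤ 1 := by
  obtain ⟨hic, hir⟩ := hM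
  rw [support_symmetricValuation] at hic hir
  set q : ℕ → ℝ := fun n => ∑ S, M.alloc (symmetricValuation n) S * ((#S : ℝ) / 2) with hq
  have hu (m n : ℕ) : M.utility (symmetricValuation m) (symmetricValuation n) =
      q n * scale m - M.price (symmetricValuation n) := by
    simp only [Mechanism.utility, symmetricValuation_apply, hq, Finset.sum_mul, mul_assoc]
  have hq1 (n : ℕ) : q n ≤ 1 := by
    rw [← M.alloc_sum (symmetricValuation n)]
    refine Finset.sum_le_sum fun S _ => mul_le_of_le_one_right (M.alloc_nonneg _ _) ?_
    have : (#S : ℝ) ≤ 2 := by exact_mod_cast card_finset_fin_le S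
    linarith
  have hq0 : 0 ≤ q 0 :=
    Finset.sum_nonneg fun S _ => mul_nonneg (M.alloc_nonneg _ _) (by positivity)
  have hsum := sum_mul_max_price_le_one (p := fun n => M.price (symmetricValuation n)) hq1 hq0
    (by have := hir _ ⟨0, rfl⟩; rw [hu] at this; linarith)
    (fun m n => by have := hic _ ⟨m, rfl⟩ _ ⟨n, rfl⟩; rwa [hu, hu] at this)
  have hle : ∫⁻ v, ENNReal.ofReal (M.price v)
      ∂(indexedDistribution symmetricValuation : Measure (BuyerValuation (Fin 2))) ≤ 1 := by
    rw [lintegral_indexedDistribution _ M.measurable_price.ennreal_ofReal]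
    apply ENNReal.tsum_le_of_sum_range_le
    intro N
    have h (n : ℕ) : ENNReal.ofReal (M.price (symmetricValuation n)) * ENNReal.ofReal (weight n) =
        ENNReal.ofReal (max (M.price (symmetricValuation n)) 0 * weight n) := by
      rw [ENNReal.ofReal_mul (le_max_right _ _), ENNReal.ofReal_max, ENNReal.ofReal_zero,
        max_eq_left zero_le]
    simp only [h]
    rw [← ENNReal.ofReal_sum_of_nonneg fun n _ =>
      mul_nonneg (le_max_right _ _) (weight_pos n).le]
    exact ENNReal.ofReal_le_one.2 (hsum N)
  calc M.revenue (indexedDistribution symmetricValuation)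
      ≤ ((∫⁻ v, ENNReal.ofReal (M.price v)
          ∂(indexedDistribution symmetricValuation : Measure (BuyerValuation (Fin 2))) :
            ENNReal) : EReal) - 0 :=
        EReal.sub_le_sub le_rfl (EReal.coe_ennreal_nonneg _)
    _ ≤ 1 := by
        rw [sub_zero]
        exact_mod_cast hle

/-- The mechanism that always sells the grand bundle at price `1`. -/
noncomputable def bundleMechanism : Mechanism (Fin 2) where
  alloc _ S := if S = univ then 1 else 0
  price _ := 1
  alloc_nonneg _ S := by split_ifs <;> norm_num
  alloc_sum _ := by simp
  measurable_alloc := measurable_const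
  measurable_price := measurable_const

lemma isTruthful_bundleMechanism :
    bundleMechanism.IsTruthful (indexedDistribution symmetricValuation) := by
  refine ⟨fun v _ w _ => le_rfl, ?_⟩
  rw [support_symmetricValuation]
  rintro _ ⟨n, rfl⟩
  simp [Mechanism.utility, bundleMechanism, symmetricValuation_apply, one_le_scale]

lemma rev_symmetricValuation : Rev (indexedDistribution symmetricValuation) = 1 := by
  apply le_antisymm
  · exact iSup_le fun M => revenue_symmetricValuation_le_one M.1 M.2
  · refine le_trans (le_of_eq ?_) (le_iSup _ ⟨bundleMechanism, isTruthful_bundleMechanism⟩)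
    simp [Mechanism.revenue, bundleMechanism]

/-! ### Lotteries with a divergent sum of gaps -/

/-- The `n`-th position on the parabola. With `k = Nat.sqrt n`, the indices `n` of the shell `k` are
those from `k ^ 2` to `k ^ 2 + 2 * k`, and their positions are equally spaced in `[0, 1]`. -/
noncomputable def position (n : ℕ) : ℝ := ((n : ℝ) - (n.sqrt : ℝ) ^ 2) / (2 * n.sqrt + 1)

/-- The height by which the shell of `n` is shifted. -/
noncomputable def shift (n : ℕ) : ℝ := 1 - 1 / ((n.sqrt : ℝ) + 1)

/-- A lower bound, in the direction `(position n, 1)`, for the gap between the `n`-th lottery and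
both the preceding lotteries and the origin. -/
noncomputable def gap (n : ℕ) : ℝ := 1 / (18 * ((n : ℝ) + 1))

lemma position_nonneg (n : ℕ) : 0 ≤ position n := by
  have h : ((n.sqrt : ℝ)) ^ 2 ≤ n := by exact_mod_cast Nat.sqrt_le' n
  exact div_nonneg (by linarith) (by positivity)

lemma position_le_one (n : ℕ) : position n ≤ 1 := by
  have h : (n : ℝ) ≤ (n.sqrt : ℝ) ^ 2 + 2 * n.sqrt := by
    have : n ≤ n.sqrt ^ 2 + 2 * n.sqrt := by
      have := Nat.sqrt_le_add n
      nlinarith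
    exact_mod_cast this
  unfold position
  rw [div_le_one (by positivity)]
  linarith

lemma shift_nonneg (n : ℕ) : 0 ≤ shift n := by
  have : 1 / ((n.sqrt : ℝ) + 1) ≤ 1 := by
    rw [div_le_one (by positivity)]
    linarith [(n.sqrt).cast_nonneg (α := ℝ)]
  unfold shift
  linarith

lemma shift_le_one (n : ℕ) : shift n ≤ 1 := by
  have : 0 ≤ 1 / ((n.sqrt : ℝ) + 1) := by positivity
  unfold shift
  linarith

lemma gap_pos (n : ℕ) : 0 < gap n := by
  unfold gap
  positivity

lemma gap_le_half (n : ℕ) : gap n ≤ 1 / 2 := by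
  unfold gap
  apply one_div_le_one_div_of_le (by norm_num)
  linarith [n.cast_nonneg (α := ℝ)]

lemma two_mul_gap_le (n : ℕ) : 2 * gap n ≤ 1 / (2 * (n.sqrt : ℝ) + 1) ^ 2 := by
  have h : (n.sqrt : ℝ) ^ 2 ≤ n := by exact_mod_cast Nat.sqrt_le' n
  have h2 : (n.sqrt : ℝ) ≤ n := by exact_mod_cast Nat.sqrt_le_self n
  have h3 : 2 * gap n = 1 / (9 * ((n : ℝ) + 1)) := by
    unfold gap
    field_simp
    norm_num
  rw [h3]
  apply one_div_le_one_div_of_le (by positivity)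
  nlinarith

lemma two_mul_gap_le_sq_add_shift_sub {j n : ℕ} (h : j < n) :
    2 * gap n ≤ (position n - position j) ^ 2 + (shift n - shift j) := by
  refine (two_mul_gap_le n).trans ?_
  rcases (Nat.sqrt_le_sqrt h.le).eq_or_lt with hk | hk
  · have hs : shift n - shift j = 0 := by simp [shift, hk]
    have hp : position n - position j = ((n : ℝ) - j) / (2 * n.sqrt + 1) := by
      simp only [position, hk]
      ring
    have hnj : (1 : ℝ) ≤ (n : ℝ) - j := by
      have : (j : ℝ) + 1 ≤ n := by exact_mod_cast h
      linarith
    rw [hs, hp, add_zero, div_pow]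
    gcongr
    nlinarith
  · have hk' : (j.sqrt : ℝ) + 1 ≤ n.sqrt := by exact_mod_cast hk
    have hpos : (0 : ℝ) < j.sqrt + 1 := by positivity
    have hn0 : (0 : ℝ) < n.sqrt := by linarith
    have h1 : 1 / (n.sqrt : ℝ) ≤ 1 / ((j.sqrt : ℝ) + 1) := one_div_le_one_div_of_le hpos hk'
    have h2 : 1 / (2 * (n.sqrt : ℝ) + 1) ^ 2 ≤ 1 / (n.sqrt : ℝ) - 1 / ((n.sqrt : ℝ) + 1) := by
      have : 1 / (n.sqrt : ℝ) - 1 / ((n.sqrt : ℝ) + 1) =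
          1 / ((n.sqrt : ℝ) * ((n.sqrt : ℝ) + 1)) := by
        field_simp
        ring
      rw [this]
      apply one_div_le_one_div_of_le (by positivity)
      nlinarith
    have h3 := sq_nonneg (position n - position j)
    unfold shift
    linarith

/-- The probabilities with which the two items are sold in the `n`-th lottery. -/
noncomputable def menuItem (n : ℕ) : ℝ × ℝ := (position n, (1 - position n ^ 2) / 2 + shift n / 2)

lemma menuItem_snd_nonneg (n : ℕ) : 0 ≤ (menuItem n).2 := by
  have h1 := position_nonneg n
  have h2 := position_le_one n
  have h3 := shift_nonneg n
  simp only [menuItem]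
  nlinarith

lemma menuItem_snd_le_one (n : ℕ) : (menuItem n).2 ≤ 1 := by
  have h3 := shift_le_one n
  simp only [menuItem]
  nlinarith [sq_nonneg (position n)]

/-- The inner product of the `n`-th lottery with the direction `(position m, 1)`: the expected value
of the lottery for the `m`-th buyer, in units of `scale m / 2`. -/
noncomputable def directionValue (m n : ℕ) : ℝ := (menuItem n).1 * position m + (menuItem n).2

lemma gap_le_menuItem_sub {j n : ℕ} (h : j < n) :
    gap n ≤ directionValue n n - directionValue n j := by
  have h1 := two_mul_gap_le_sq_add_shift_sub h
  simp only [directionValue, menuItem]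
  nlinarith

lemma gap_le_directionValue (n : ℕ) : gap n ≤ directionValue n n := by
  have h1 := gap_le_half n
  have h2 := shift_nonneg n
  simp only [directionValue, menuItem]
  nlinarith [sq_nonneg (position n)]

lemma directionValue_le_two (m n : ℕ) : directionValue m n ≤ 2 := by
  have h1 := mul_le_one₀ (position_le_one n) (position_nonneg m) (position_le_one m)
  have h2 := menuItem_snd_le_one n
  simp only [directionValue]
  have : (menuItem n).1 = position n := rfl
  rw [this]
  linarith

/-! ### The dominated distribution -/

/-- The `n`-th valuation of the dominated distribution. -/
noncomputable def skewedValuation (n : ℕ) : BuyerValuation (Fin 2) :=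
  additiveValuation ![scale n / 2 * position n, scale n / 2] fun i => by
    have := scale_pos n
    have := position_nonneg n
    fin_cases i <;> simp <;> positivity

lemma support_skewedValuation :
    (indexedDistribution skewedValuation : Measure (BuyerValuation (Fin 2))).support =
      Set.range skewedValuation :=
  support_indexedDistribution fun n => by simp [skewedValuation, additiveValuation]

lemma skewedValuation_injective : Function.Injective skewedValuation := by
  intro m n h
  by_contra hmn
  have h1 := one_le_abs_scale_sub hmn
  have h2 : (skewedValuation m).1 {1} = (skewedValuation n).1 {1} := by rw [h]
  simp only [skewedValuation, additiveValuation, sum_singleton, Matrix.cons_val_one,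
    Matrix.cons_val_fin_one] at h2
  rw [show scale m - scale n = 0 by linarith, abs_zero] at h1
  linarith

lemma skewedValuation_le_symmetricValuation (n : ℕ) (S : Finset (Fin 2)) :
    (skewedValuation n).1 S ≤ (symmetricValuation n).1 S := by
  refine Finset.sum_le_sum fun i _ => ?_
  have h1 := scale_pos n
  have h2 := position_le_one n
  fin_cases i
  · exact mul_le_of_le_one_right (by positivity) h2
  · exact le_rfl

/-- The random set that contains the items independently with probabilities `menuItem n`. -/
noncomputable def lottery (n : ℕ) (S : Finset (Fin 2)) : ℝ :=
  (if 0 ∈ S then (menuItem n).1 else 1 - (menuItem n).1) *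
    (if 1 ∈ S then (menuItem n).2 else 1 - (menuItem n).2)

lemma univ_finset_fin_two :
    (univ : Finset (Finset (Fin 2))) = {∅, {0}, {1}, {0, 1}} := by decide

lemma sum_finset_fin_two (f : Finset (Fin 2) → ℝ) :
    ∑ S, f S = f ∅ + f {0} + f {1} + f {0, 1} := by
  rw [univ_finset_fin_two, sum_insert (by decide), sum_insert (by decide), sum_insert (by decide),
    sum_singleton]
  ring

lemma lottery_nonneg (n : ℕ) (S : Finset (Fin 2)) : 0 ≤ lottery n S := by
  have h1 : 0 ≤ (menuItem n).1 := position_nonneg n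
  have h2 : (menuItem n).1 ≤ 1 := position_le_one n
  have h3 := menuItem_snd_nonneg n
  have h4 := menuItem_snd_le_one n
  unfold lottery
  apply mul_nonneg <;> split_ifs <;> linarith

lemma sum_lottery (n : ℕ) : ∑ S, lottery n S = 1 := by
  rw [sum_finset_fin_two]
  simp [lottery]
  ring

lemma sum_lottery_mul_skewedValuation (m n : ℕ) :
    ∑ S, lottery n S * (skewedValuation m).1 S = scale m / 2 * directionValue m n := by
  rw [sum_finset_fin_two]
  simp [lottery, skewedValuation, additiveValuation, directionValue]
  ring

/-- The price of the `n`-th lottery. -/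
noncomputable def menuPrice (n : ℕ) : ℝ := scale n / 2 * gap n

lemma menuPrice_pos (n : ℕ) : 0 < menuPrice n :=
  mul_pos (half_pos (scale_pos n)) (gap_pos n)

lemma menuPrice_succ (n : ℕ) : menuPrice (n + 1) = scale n := by
  unfold menuPrice gap
  rw [scale_succ]
  push_cast
  have : (n : ℝ) + 2 ≠ 0 := by positivity
  rw [show (n : ℝ) + 1 + 1 = n + 2 by ring]
  field_simp
  ring

lemma scale_le_menuPrice {m n : ℕ} (h : m < n) : scale m ≤ menuPrice n := by
  obtain ⟨k, rfl⟩ : ∃ k, n = k + 1 := ⟨n - 1, by omega⟩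
  rw [menuPrice_succ]
  exact scale_monotone (by omega)

lemma menu_individually_rational (n : ℕ) :
    0 ≤ scale n / 2 * directionValue n n - menuPrice n := by
  unfold menuPrice
  rw [← mul_sub]
  exact mul_nonneg (half_pos (scale_pos n)).le (by linarith [gap_le_directionValue n])

lemma menu_incentive_compatible (m n : ℕ) :
    scale m / 2 * directionValue m n - menuPrice n ≤
      scale m / 2 * directionValue m m - menuPrice m := by
  have hs := scale_pos m
  rcases lt_trichotomy n m with h | rfl | h
  · have h1 := mul_le_mul_of_nonneg_left (gap_le_menuItem_sub h) (half_pos hs).le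
    rw [mul_sub] at h1
    have h2 := (menuPrice_pos n).le
    have h3 : menuPrice m = scale m / 2 * gap m := rfl
    linarith
  · exact le_rfl
  · have h1 := mul_le_mul_of_nonneg_left (directionValue_le_two m n) (half_pos hs).le
    linarith [scale_le_menuPrice h, menu_individually_rational m]

lemma measurable_extend_skewedValuation {X : Type*} [MeasurableSpace X] (f : ℕ → X) :
    Measurable (Function.extend skewedValuation f fun _ => f 0) := by
  refine (measurable_const (a := f 0)).measurable_of_countable_ne
    ((Set.countable_range skewedValuation).mono fun v hv => ?_)
  by_contra h
  exact hv (Function.extend_apply' f (fun _ => f 0) v h).symm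

/-- The mechanism that sells the lottery `n` at price `menuPrice n` on the report
`skewedValuation n`. Reports outside the support are treated like `skewedValuation 0`. -/
noncomputable def menuMechanism : Mechanism (Fin 2) where
  alloc := Function.extend skewedValuation lottery fun _ => lottery 0
  price := Function.extend skewedValuation menuPrice fun _ => menuPrice 0
  alloc_nonneg v S := by
    by_cases h : ∃ n, skewedValuation n = v
    · obtain ⟨n, rfl⟩ := h
      rw [skewedValuation_injective.extend_apply]
      exact lottery_nonneg n S
    · rw [Function.extend_apply' _ _ _ h]
      exact lottery_nonneg 0 S
  alloc_sum v := by
    by_cases h : ∃ n, skewedValuation n = v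
    · obtain ⟨n, rfl⟩ := h
      rw [skewedValuation_injective.extend_apply]
      exact sum_lottery n
    · rw [Function.extend_apply' _ _ _ h]
      exact sum_lottery 0
  measurable_alloc := measurable_extend_skewedValuation lottery
  measurable_price := measurable_extend_skewedValuation menuPrice

lemma menuMechanism_price (n : ℕ) : menuMechanism.price (skewedValuation n) = menuPrice n :=
  skewedValuation_injective.extend_apply menuPrice (fun _ => menuPrice 0) n

lemma menuMechanism_utility (m n : ℕ) :
    menuMechanism.utility (skewedValuation m) (skewedValuation n) =
      scale m / 2 * directionValue m n - menuPrice n := by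
  rw [Mechanism.utility, menuMechanism_price, ← sum_lottery_mul_skewedValuation]
  simp only [menuMechanism, skewedValuation_injective.extend_apply]

lemma isTruthful_menuMechanism :
    menuMechanism.IsTruthful (indexedDistribution skewedValuation) := by
  unfold Mechanism.IsTruthful
  rw [support_skewedValuation]
  constructor
  · rintro _ ⟨m, rfl⟩ _ ⟨n, rfl⟩
    rw [menuMechanism_utility, menuMechanism_utility]
    exact menu_incentive_compatible m n
  · rintro _ ⟨n, rfl⟩
    rw [menuMechanism_utility]
    exact menu_individually_rational n

lemma tsum_menuPrice_mul_weight :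
    ∑' n, ENNReal.ofReal (menuPrice n) * ENNReal.ofReal (weight n) = ⊤ := by
  have hle (n : ℕ) : 1 / 72 * (1 / ((n : ℝ) + 1)) ≤ menuPrice n * weight n := by
    have h := mul_le_mul_of_nonneg_left (half_inv_scale_le_weight n) (menuPrice_pos n).le
    refine le_trans (le_of_eq ?_) h
    have := (scale_pos n).ne'
    unfold menuPrice gap
    field_simp
    norm_num
  have hns : ¬ Summable fun n => menuPrice n * weight n := by
    intro hs
    have h1 : Summable fun n : ℕ => 1 / 72 * (1 / ((n : ℝ) + 1)) :=
      Summable.of_nonneg_of_le (fun n => by positivity) hle hs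
    rw [summable_mul_left_iff (by norm_num)] at h1
    refine Real.not_summable_one_div_natCast ((summable_nat_add_iff 1).1 ?_)
    simpa using h1
  by_contra htop
  apply hns
  have h2 := ENNReal.summable_toReal htop
  refine h2.congr fun n => ?_
  rw [ENNReal.toReal_mul, ENNReal.toReal_ofReal (menuPrice_pos n).le,
    ENNReal.toReal_ofReal (weight_pos n).le]

lemma rev_skewedValuation : Rev (indexedDistribution skewedValuation) = ⊤ := by
  rw [eq_top_iff]
  refine le_trans (le_of_eq ?_) (le_iSup _ ⟨menuMechanism, isTruthful_menuMechanism⟩)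
  have hpos : ∫⁻ v, ENNReal.ofReal (menuMechanism.price v)
      ∂(indexedDistribution skewedValuation : Measure (BuyerValuation (Fin 2))) = ⊤ := by
    rw [lintegral_indexedDistribution _ menuMechanism.measurable_price.ennreal_ofReal]
    simp only [menuMechanism_price]
    exact tsum_menuPrice_mul_weight
  have hneg : ∫⁻ v, ENNReal.ofReal (-menuMechanism.price v)
      ∂(indexedDistribution skewedValuation : Measure (BuyerValuation (Fin 2))) = 0 := by
    rw [lintegral_indexedDistribution (f := fun v => ENNReal.ofReal (-menuMechanism.price v)) _
      menuMechanism.measurable_price.neg.ennreal_ofReal]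
    simp [menuMechanism_price, ENNReal.ofReal_of_nonpos, (menuPrice_pos _).le]
  simp [Mechanism.revenue, hpos, hneg]

theorem mainTheorem7 :
    (∃ D ∈ correlatedAdditive (Fin 2), ∃ Dplus ∈ correlatedAdditive (Fin 2),
      StochDominates Dplus D ∧ Rev Dplus = 1 ∧ Rev D = ⊤) ∧
    ∀ c : ℝ, ¬ ApproxRevenueMonotone c (correlatedAdditive (Fin 2)) := by
  have hex : ∃ D ∈ correlatedAdditive (Fin 2), ∃ Dplus ∈ correlatedAdditive (Fin 2),
      StochDominates Dplus D ∧ Rev Dplus = 1 ∧ Rev D = ⊤ :=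
    ⟨indexedDistribution skewedValuation,
      indexedDistribution_mem_correlatedAdditive fun _ =>
        isAdditiveValuation_additiveValuation _ _,
      indexedDistribution symmetricValuation,
      indexedDistribution_mem_correlatedAdditive fun _ =>
        isAdditiveValuation_additiveValuation _ _,
      stochDominates_indexedDistribution skewedValuation_le_symmetricValuation,
      rev_symmetricValuation, rev_skewedValuation⟩
  refine ⟨hex, fun c hc => ?_⟩
  obtain ⟨D, hD, Dplus, hDplus, hdom, h1, htop⟩ := hex
  have h := hc D hD Dplus hDplus hdom
  rw [h1, htop, mul_one] at h
  exact EReal.coe_ne_top c (top_le_iff.1 h)
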